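/- Morphisms are composed from left to right. A *category with subobjects* is a small category $\mathcal C$ with a subcategory $\mathcal P$ on the same objects, whose morphisms are called *inclusions*, such that $\mathcal P$ is a strict preorder (at most one inclusion $j(a,b)\colon a\to b$ for any two objects, and the only isomorphisms of $\mathcal P$ are identities), every inclusion is a monomorphism of $\mathcal C$, and if $hg$ and $g$ are inclusions then so is $h$. Write $a\preceq b$ if there is an inclusion $a\to b$. A *retraction* is a morphism $q\colon b\to a$ with $j(a,b)q=1_a$ for some inclusion $j(a,b)$. A *cone* with vertex $z$ is a family $\gamma(c)\colon c\to z$, indexed by all objects $c$, with $j(a,b)\gamma(b)=\gamma(a)$ whenever $a\preceq b$ and with $\gamma(c)$ an isomorphism for at least one $c$. The category $\mathcal C$ is *normal* if every inclusion has a right inverse, every morphism $f$ can be written $f=quj$ with $q$ a retraction, $u$ an isomorphism and $j$ an inclusion, and for every object $c$ there is a cone $\mu$ with vertex $c$ and $\mu(c)=1_c$. In a normal category the morphism $f^\circ=qu$ depends on $f$ only, and the set $\widehat{\mathcal C}$ of all cones is a regular semigroup under the product whose components are $(\gamma\cdot\delta)(c)=\gamma(c)\,(\delta(z_\gamma))^\circ$,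 where $z_\gamma$ is the vertex of $\gamma$. A normal category is *bounded above* if it has an object $k$ with $c\preceq k$ for all objects $c$. For a regular semigroup $S$, the set $S/\mathscr R$ of $\mathscr R$-classes is partially ordered by $R_a\sqsubseteq R_b$ iff $a\in bS$. In a normal category, an object $c$ is *connected by* $\mathfrak d\in\widehat{\mathcal C}/\mathscr R$ if $\mathfrak d$ contains an idempotent cone with vertex $c$; this cone is then unique and is denoted $\epsilon(c,\mathfrak d)$. A *CC-morphism* from a normal category $\mathcal C$ to a normal category $\mathcal C'$ is a pair $(F,G)$ of a functor $F\colon\mathcal C\to\mathcal C'$ that maps inclusions to inclusions and an order preserving map $G\colon\widehat{\mathcal C}/\mathscr R\to\widehat{\mathcal C'}/\mathscr R$ such that, whenever $c$ is connected by $\mathfrak d$, the object $F(c)$ is connected by $G(\mathfrak d)$ and $F(\epsilon(c,\mathfrak d)(c'))=\epsilon(F(c),G(\mathfrak d))(F(c'))$ for every object $c'$ of $\mathcal C$. **Theorem.** If $\mathcal C$ is a bounded above normal category, then the semigroup $\widehat{\mathcal C}$ of all cones in $\mathcal C$ is a regular monoid. The category of regular monoids, with all semigroup homomorphisms as morphisms,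 is equivalent to the category of bounded above normal categories, with CC-morphisms as morphisms. -/

import Mathlib

open CategoryTheory

universe u v

namespace ConnCat

/-! ### Regular semigroups, the quasi-order `≤ᵣ` and the poset `S/ℛ` -/

/-- A semigroup is regular if every element has an inverse in the sense of von Neumann. -/
class IsRegularSemigroup (S : Type u) [Semigroup S] : Prop where
  exists_inverse : ∀ a : S, ∃ x : S, a * x * a = a ∧ x * a * x = x

/-- The quasi-order `a ≤ᵣ b ↔ a ∈ bS` of a regular semigroup `S`. -/
abbrev greenR (S : Type u) [Semigroup S] [IsRegularSemigroup S] : Preorder S where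
  le a b := ∃ x : S, a = b * x
  le_refl a := by
    obtain ⟨x, hx, -⟩ := IsRegularSemigroup.exists_inverse a
    exact ⟨x * a, by rw [← mul_assoc, hx]⟩
  le_trans a b c := by
    rintro ⟨x, rfl⟩ ⟨y, rfl⟩
    exact ⟨y * x, by rw [mul_assoc]⟩

/-- The set `S/ℛ` of `ℛ`-classes, where `ℛ` is `≤ᵣ` intersected with its converse. -/
def RClasses (S : Type u) [Semigroup S] [IsRegularSemigroup S] : Type u :=
  @Antisymmetrization S (greenR S).le _

/-- `S/ℛ` is partially ordered by `R_a ⊑ R_b ↔ a ≤ᵣ b`. -/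
instance (S : Type u) [Semigroup S] [IsRegularSemigroup S] : PartialOrder (RClasses S) :=
  @instPartialOrderAntisymmetrization S (greenR S)

/-- The `ℛ`-class `R_a`. -/
def RClasses.mk {S : Type u} [Semigroup S] [IsRegularSemigroup S] (a : S) : RClasses S :=
  @toAntisymmetrization S (greenR S).le _ a

theorem RClasses.mk_le_mk {S : Type u} [Semigroup S] [IsRegularSemigroup S] (a b : S) :
    RClasses.mk a ≤ RClasses.mk b ↔ ∃ x : S, a = b * x := Iff.rfl

/-! ### Categories with subobjects -/

/-- A category with subobjects: a wide subcategory of morphisms, called inclusions, which is a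
strict preorder (there is at most one inclusion between two objects, and two objects with
inclusions in both directions are equal), which consists of monomorphisms, and such that
`h ≫ g` and `g` being inclusions forces `h` to be one. -/
class SubobjectCategory (C : Type u) [Category.{v} C] where
  /-- The class of inclusions. -/
  incl : MorphismProperty C
  incl_id : ∀ a : C, incl (𝟙 a)
  incl_comp : ∀ {a b c : C} (f : a ⟶ b) (g : b ⟶ c), incl f → incl g → incl (f ≫ g)
  incl_unique : ∀ {a b : C} (f g : a ⟶ b), incl f → incl g → f = g
  incl_antisymm : ∀ {a b : C} (f : a ⟶ b) (g : b ⟶ a), incl f → incl g → a = b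
  incl_mono : ∀ {a b : C} (f : a ⟶ b), incl f → Mono f
  incl_of_comp : ∀ {a b c : C} (h : a ⟶ b) (g : b ⟶ c), incl g → incl (h ≫ g) → incl h

section Subobjects

variable {C : Type u} [Category.{v} C] [SubobjectCategory C]

/-- `f` is an inclusion. -/
def Incl {a b : C} (f : a ⟶ b) : Prop := SubobjectCategory.incl f

/-- `a ⪯ b`: there is an inclusion from `a` to `b`. -/
def SubLE (a b : C) : Prop := ∃ j : a ⟶ b, Incl j

/-- A retraction: a right inverse of some inclusion. -/
def IsRetraction {a b : C} (q : a ⟶ b) : Prop := ∃ j : b ⟶ a, Incl j ∧ j ≫ q = 𝟙 b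

/-- A normal factorisation `f = q u j` into a retraction, an isomorphism and an inclusion. -/
structure NormalFactorisation {a b : C} (f : a ⟶ b) where
  /-- The coimage belonging to the factorisation. -/
  coim : C
  /-- The image belonging to the factorisation. -/
  im : C
  q : a ⟶ coim
  u : coim ⟶ im
  j : im ⟶ b
  retraction : IsRetraction q
  iso : IsIso u
  inclusion : Incl j
  fac : q ≫ u ≫ j = f

/-- A cone with vertex `z`: a family of morphisms `γ(c) : c ⟶ z`, compatible with the inclusions,
at least one of which is an isomorphism. -/
@[ext]
structure NormalCone (z : C) where
  app : ∀ c : C, c ⟶ z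
  naturality : ∀ {a b : C} (j : a ⟶ b), Incl j → j ≫ app b = app a
  exists_iso : ∃ c : C, IsIso (app c)

end Subobjects

/-! ### Normal categories and their semigroups of cones -/

/-- A category with subobjects is normal if all inclusions split, every morphism has a normal
factorisation, and every object `c` is the vertex of a cone with component `𝟙 c` at `c`. -/
class IsNormalCategory (C : Type u) [Category.{v} C] [SubobjectCategory C] : Prop where
  splits : ∀ {a b : C} (j : a ⟶ b), Incl j → ∃ q : b ⟶ a, j ≫ q = 𝟙 a
  exists_normalFactorisation : ∀ {a b : C} (f : a ⟶ b), Nonempty (NormalFactorisation f)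
  exists_cone : ∀ c : C, ∃ μ : NormalCone c, μ.app c = 𝟙 c

section Normal

variable {C : Type u} [Category.{v} C] [SubobjectCategory C] [IsNormalCategory C]

/-- A chosen normal factorisation. The image `im f` and the epimorphic component `epiPart f`
below do not depend on the choice. -/
noncomputable def normalFactorisation {a b : C} (f : a ⟶ b) : NormalFactorisation f :=
  (IsNormalCategory.exists_normalFactorisation f).some

/-- The image of `f`. -/
noncomputable abbrev im {a b : C} (f : a ⟶ b) : C := (normalFactorisation f).im

/-- The epimorphic component `f°` of `f`. -/
noncomputable def epiPart {a b : C} (f : a ⟶ b) : a ⟶ im f :=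
  (normalFactorisation f).q ≫ (normalFactorisation f).u

/-- The inclusion `j_f` of `f`. -/
noncomputable def inclPart {a b : C} (f : a ⟶ b) : im f ⟶ b := (normalFactorisation f).j

theorem inclPart_incl {a b : C} (f : a ⟶ b) : Incl (inclPart f) :=
  (normalFactorisation f).inclusion

theorem epiPart_inclPart {a b : C} (f : a ⟶ b) : epiPart f ≫ inclPart f = f := by
  rw [epiPart, inclPart, Category.assoc, (normalFactorisation f).fac]

theorem exists_section_epiPart {a b : C} (f : a ⟶ b) :
    ∃ s : im f ⟶ a, s ≫ epiPart f = 𝟙 (im f) := by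
  obtain ⟨j, -, hj⟩ := (normalFactorisation f).retraction
  have : IsIso (normalFactorisation f).u := (normalFactorisation f).iso
  refine ⟨(inv (normalFactorisation f).u : (normalFactorisation f).im ⟶ _) ≫ j, ?_⟩
  rw [epiPart, Category.assoc, reassoc_of% hj, IsIso.inv_hom_id]

instance epi_epiPart {a b : C} (f : a ⟶ b) : Epi (epiPart f) := by
  obtain ⟨s, hs⟩ := exists_section_epiPart f
  exact (SplitEpi.mk s hs).epi

/-- The inclusion of an epimorphism is an isomorphism. -/
theorem isIso_inclPart {a b : C} (f : a ⟶ b) [Epi f] : IsIso (inclPart f) := by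
  obtain ⟨r, hr⟩ := IsNormalCategory.splits _ (inclPart_incl f)
  have : Epi (inclPart f) := by
    have : Epi (epiPart f ≫ inclPart f) := by rw [epiPart_inclPart]; infer_instance
    exact epi_of_epi (epiPart f) (inclPart f)
  have : IsSplitMono (inclPart f) := ⟨⟨⟨r, hr⟩⟩⟩
  exact isIso_of_epi_of_isSplitMono _

theorem exists_section_of_epi {a b : C} (f : a ⟶ b) [Epi f] : ∃ s : b ⟶ a, s ≫ f = 𝟙 b := by
  obtain ⟨s, hs⟩ := exists_section_epiPart f
  have := isIso_inclPart f
  refine ⟨inv (inclPart f) ≫ s, ?_⟩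
  rw [← cancel_mono (inv (inclPart f))]
  have : f ≫ inv (inclPart f) = epiPart f := by
    rw [IsIso.comp_inv_eq, epiPart_inclPart]
  simp [this, hs]

/-- The cone `γ ∗ f`, with components `γ(c) f`, for an epimorphism `f` out of the vertex. -/
def NormalCone.star {z w : C} (γ : NormalCone z) (f : z ⟶ w) [Epi f] : NormalCone w where
  app c := γ.app c ≫ f
  naturality j hj := by rw [← Category.assoc, γ.naturality j hj]
  exists_iso := by
    obtain ⟨c, hc⟩ := γ.exists_iso
    obtain ⟨s, hs⟩ := exists_section_of_epi f
    let m : w ⟶ c := s ≫ inv (γ.app c)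
    have hm : m ≫ γ.app c ≫ f = 𝟙 w := by simp [m, hs]
    have h1 : epiPart m ≫ γ.app (im m) ≫ f = 𝟙 w := by
      rw [← γ.naturality _ (inclPart_incl m), Category.assoc, ← Category.assoc,
        epiPart_inclPart, hm]
    have : IsSplitMono (epiPart m) := ⟨⟨⟨_, h1⟩⟩⟩
    have : IsIso (epiPart m) := isIso_of_epi_of_isSplitMono _
    refine ⟨im m, ?_⟩
    rw [IsIso.eq_inv_of_hom_inv_id h1]
    infer_instance

variable (C) in
/-- The set `Ĉ` of all cones in `C`: a vertex together with a cone with that vertex. -/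
structure Cones where
  vertex : C
  cone : NormalCone vertex

theorem Cones.star_congr {z w w' b : C} (γ : NormalCone z) (p : z ⟶ w) (p' : z ⟶ w') [Epi p]
    [Epi p'] (j : w ⟶ b) (j' : w' ⟶ b) (hj : Incl j) (hj' : Incl j') (h : p ≫ j = p' ≫ j') :
    (⟨w, γ.star p⟩ : Cones C) = ⟨w', γ.star p'⟩ := by
  obtain ⟨s, hs⟩ := exists_section_of_epi p
  obtain ⟨s', hs'⟩ := exists_section_of_epi p'
  have e1 : (s ≫ p') ≫ j' = j := by rw [Category.assoc, ← h, reassoc_of% hs]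
  have e2 : (s' ≫ p) ≫ j = j' := by rw [Category.assoc, h, reassoc_of% hs']
  obtain rfl : w = w' := SubobjectCategory.incl_antisymm (s ≫ p') (s' ≫ p)
    (SubobjectCategory.incl_of_comp _ j' hj' (by rw [e1]; exact hj))
    (SubobjectCategory.incl_of_comp _ j hj (by rw [e2]; exact hj'))
  obtain rfl := SubobjectCategory.incl_unique j j' hj hj'
  have := SubobjectCategory.incl_mono j hj
  obtain rfl : p = p' := (cancel_mono j).1 h
  rfl

/-- The product of cones `γ · δ = γ ∗ (δ(z_γ))°`. -/
noncomputable instance : Mul (Cones C) where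
  mul γ δ := ⟨im (δ.cone.app γ.vertex), γ.cone.star (epiPart (δ.cone.app γ.vertex))⟩

theorem Cones.mul_def (γ δ : Cones C) :
    γ * δ = ⟨im (δ.cone.app γ.vertex), γ.cone.star (epiPart (δ.cone.app γ.vertex))⟩ := rfl

/-- The semigroup `Ĉ` of all cones in a normal category. -/
noncomputable instance : Semigroup (Cones C) where
  mul_assoc α β γ := by
    have h : (α * β) * γ = ⟨_, α.cone.star (epiPart (β.cone.app α.vertex) ≫
        epiPart (γ.cone.app (im (β.cone.app α.vertex))))⟩ := by
      simp only [Cones.mul_def, NormalCone.star, Category.assoc]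
    rw [h]
    refine Cones.star_congr α.cone _ _ (inclPart _) (inclPart _ ≫ inclPart (γ.cone.app β.vertex))
      (inclPart_incl _)
      (SubobjectCategory.incl_comp _ _ (inclPart_incl _) (inclPart_incl _)) ?_
    rw [Category.assoc, epiPart_inclPart, ← Category.assoc, epiPart_inclPart]
    change _ = (β.cone.app α.vertex ≫ epiPart (γ.cone.app β.vertex)) ≫ _
    rw [Category.assoc, epiPart_inclPart, ← γ.cone.naturality _ (inclPart_incl (β.cone.app α.vertex)),
      ← Category.assoc, epiPart_inclPart]

theorem Cones.mul_of_epi (γ δ : Cones C) [Epi (δ.cone.app γ.vertex)] :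
    γ * δ = ⟨δ.vertex, γ.cone.star (δ.cone.app γ.vertex)⟩ :=
  Cones.star_congr γ.cone _ _ (inclPart _) (𝟙 _) (inclPart_incl _) (SubobjectCategory.incl_id _)
    (by rw [epiPart_inclPart, Category.comp_id])

/-- The semigroup of cones is regular. -/
instance : IsRegularSemigroup (Cones C) where
  exists_inverse γ := by
    obtain ⟨z, γ⟩ := γ
    obtain ⟨d, hd⟩ := γ.exists_iso
    obtain ⟨μ, hμ⟩ := IsNormalCategory.exists_cone z
    let χ : Cones C := ⟨d, μ.star (inv (γ.app d))⟩
    have hχ : χ.cone.app z = inv (γ.app d) := by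
      change μ.app z ≫ inv (γ.app d) = _
      rw [hμ, Category.id_comp]
    have : IsIso (χ.cone.app z) := by rw [hχ]; infer_instance
    have h1 : (⟨z, γ⟩ : Cones C) * χ = ⟨d, γ.star (inv (γ.app d))⟩ := by
      have : Epi (χ.cone.app (⟨z, γ⟩ : Cones C).vertex) := by
        change Epi (χ.cone.app z); infer_instance
      rw [Cones.mul_of_epi]
      simp only [NormalCone.star, hχ]
      rfl
    have : Epi ((⟨z, γ⟩ : Cones C).cone.app χ.vertex) := by
      change Epi (γ.app d); infer_instance
    have h2 : χ * (⟨z, γ⟩ : Cones C) = ⟨z, μ⟩ := by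
      rw [Cones.mul_of_epi]
      simp [NormalCone.star, χ]
    refine ⟨χ, ?_, ?_⟩
    · rw [mul_assoc, h2]
      have : Epi ((⟨z, μ⟩ : Cones C).cone.app (⟨z, γ⟩ : Cones C).vertex) := by
        change Epi (μ.app z); rw [hμ]; infer_instance
      rw [Cones.mul_of_epi]
      simp [NormalCone.star, hμ]
    · rw [h2]
      have : Epi (χ.cone.app (⟨z, μ⟩ : Cones C).vertex) := by
        change Epi (χ.cone.app z); infer_instance
      rw [Cones.mul_of_epi]
      simp only [NormalCone.star, hχ]
      rfl

/-- `ε` is the idempotent cone `ε(c, 𝔡)`: it is idempotent, its vertex is `c` and its `ℛ`-class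
is `𝔡`. -/
def IsIdempotentConeOf {c : C} (ε : NormalCone c) (d : RClasses (Cones C)) : Prop :=
  IsIdempotentElem (⟨c, ε⟩ : Cones C) ∧ RClasses.mk (⟨c, ε⟩ : Cones C) = d

theorem NormalCone.comp_eq_id_of_star_eq {c w : C} (ε : NormalCone c) (p : c ⟶ w) [Epi p]
    (j : w ⟶ c) (hj : Incl j) (h : (⟨w, ε.star p⟩ : Cones C) = ⟨c, ε⟩) : p ≫ j = 𝟙 c := by
  obtain ⟨rfl, h'⟩ := (Cones.mk.injEq ..).mp h
  obtain rfl := SubobjectCategory.incl_unique j (𝟙 _) hj (SubobjectCategory.incl_id _)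
  obtain ⟨d, hd⟩ := ε.exists_iso
  have h2 : ε.app d ≫ p = ε.app d := congrArg (fun γ => NormalCone.app γ d) (eq_of_heq h')
  rw [Category.comp_id, ← cancel_epi (ε.app d), h2, Category.comp_id]

/-- A cone with vertex `c` is idempotent if and only if its component at `c` is the identity. -/
theorem isIdempotentElem_cone_iff {c : C} (ε : NormalCone c) :
    IsIdempotentElem (⟨c, ε⟩ : Cones C) ↔ ε.app c = 𝟙 c := by
  constructor
  · intro h
    rw [← epiPart_inclPart (ε.app c)]
    exact ε.comp_eq_id_of_star_eq _ _ (inclPart_incl _) h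
  · intro h
    have : Epi ((⟨c, ε⟩ : Cones C).cone.app (⟨c, ε⟩ : Cones C).vertex) := by
      change Epi (ε.app c); rw [h]; infer_instance
    rw [IsIdempotentElem, Cones.mul_of_epi]
    simp [NormalCone.star, h]

/-- The idempotent cone `ε(c, 𝔡)` is determined by `c` and `𝔡`. -/
theorem IsIdempotentConeOf.unique {c : C} {ε ε' : NormalCone c} {d : RClasses (Cones C)}
    (h : IsIdempotentConeOf ε d) (h' : IsIdempotentConeOf ε' d) : ε = ε' := by
  obtain ⟨x, hx⟩ := (RClasses.mk_le_mk (⟨c, ε⟩ : Cones C) ⟨c, ε'⟩).1 (h.2.trans h'.2.symm).le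
  have h1 : (⟨c, ε'⟩ : Cones C) * ⟨c, ε⟩ = ⟨c, ε⟩ := by
    rw [hx, ← mul_assoc, h'.1]
  have hε := (isIdempotentElem_cone_iff ε).1 h.1
  have : Epi ((⟨c, ε⟩ : Cones C).cone.app (⟨c, ε'⟩ : Cones C).vertex) := by
    change Epi (ε.app c); rw [hε]; infer_instance
  rw [Cones.mul_of_epi] at h1
  have h2 := eq_of_heq ((Cones.mk.injEq ..).mp h1).2
  rw [← h2]
  simp [NormalCone.star, hε]

/-- The object `c` is connected by `𝔡`: there is an idempotent cone in `𝔡` with vertex `c`. -/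
def IsConnectedBy (c : C) (d : RClasses (Cones C)) : Prop :=
  ∃ ε : NormalCone c, IsIdempotentConeOf ε d

end Normal

/-! ### Connected categories and CC-morphisms -/

/-- A connected category `C_𝔇`: a small normal category `C` with a down-set `𝔇` of `Ĉ/ℛ` such that
every object of `C` is connected by some member of `𝔇`. -/
structure ConnectedCategory where
  carrier : Type u
  [cat : SmallCategory carrier]
  [subobjects : SubobjectCategory carrier]
  [normal : IsNormalCategory carrier]
  downSet : LowerSet (RClasses (Cones carrier))
  connected : ∀ c : carrier, ∃ d ∈ downSet, IsConnectedBy c d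

attribute [instance] ConnectedCategory.cat ConnectedCategory.subobjects ConnectedCategory.normal

/-- A CC-morphism `(F, G)` between connected categories. -/
@[ext]
structure CCHom (X Y : ConnectedCategory.{u}) where
  F : X.carrier ⥤ Y.carrier
  G : X.downSet →o Y.downSet
  map_incl : ∀ {a b : X.carrier} (j : a ⟶ b), Incl j → Incl (F.map j)
  map_connected : ∀ (c : X.carrier) (d : X.downSet),
    IsConnectedBy c d.1 → IsConnectedBy (F.obj c) (G d).1
  map_cone : ∀ (c : X.carrier) (d : X.downSet) (ε : NormalCone c) (ε' : NormalCone (F.obj c)),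
    IsIdempotentConeOf ε d.1 → IsIdempotentConeOf ε' (G d).1 →
      ∀ c' : X.carrier, F.map (ε.app c') = ε'.app (F.obj c')

/-- The identity CC-morphism. -/
noncomputable def CCHom.id (X : ConnectedCategory.{u}) : CCHom X X where
  F := 𝟭 _
  G := OrderHom.id
  map_incl _ hj := hj
  map_connected _ _ h := h
  map_cone _ _ _ _ hε hε' c' := congrArg (fun γ => NormalCone.app γ c') (hε.unique hε')

/-- Composition of CC-morphisms. -/
noncomputable def CCHom.comp {X Y Z : ConnectedCategory.{u}} (m : CCHom X Y) (n : CCHom Y Z) : CCHom X Z where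
  F := m.F ⋙ n.F
  G := n.G.comp m.G
  map_incl _ hj := n.map_incl _ (m.map_incl _ hj)
  map_connected _ _ h := n.map_connected _ _ (m.map_connected _ _ h)
  map_cone c d ε ε'' hε hε'' c' := by
    obtain ⟨ε', hε'⟩ := m.map_connected c d ⟨ε, hε⟩
    exact (congrArg n.F.map (m.map_cone c d ε ε' hε hε' c')).trans
      (n.map_cone _ _ ε' ε'' hε' hε'' _)

/-- The category `CC` of connected categories and CC-morphisms. -/
noncomputable instance : Category ConnectedCategory.{u} where
  Hom := CCHom
  id := CCHom.id
  comp := CCHom.comp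

/-- A category with subobjects is bounded above if it has a largest object. -/
def IsBoundedAbove (C : Type u) [Category.{v} C] [SubobjectCategory C] : Prop :=
  ∃ k : C, ∀ c : C, SubLE c k

/-- A normal category is regarded as the connected category with `𝔇 = Ĉ/ℛ`. This property of a
connected category says that it is a bounded above normal category in this sense. -/
def isBoundedAboveNormal : ObjectProperty ConnectedCategory.{u} :=
  fun X => X.downSet = ⊤ ∧ IsBoundedAbove X.carrier

/-- The category of bounded above normal categories with CC-morphisms, a full subcategory of the
category of connected categories. -/
abbrev BoundedAboveNormalCategory : Type (u + 1) :=
  (isBoundedAboveNormal.{u}).FullSubcategory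

/-- A regular semigroup with an identity element. -/
def IsRegularMonoid (S : Type u) [Semigroup S] : Prop :=
  IsRegularSemigroup S ∧ ∃ e : S, ∀ a : S, e * a = a ∧ a * e = a

/-- The property of a semigroup of being a regular monoid. -/
def isRegularMonoid : ObjectProperty Semigrp.{u} := fun S => IsRegularMonoid S

/-- The category of regular monoids, a full subcategory of the category of semigroups: its
morphisms are the semigroup homomorphisms. -/
abbrev RegularMonoid : Type (u + 1) := (isRegularMonoid.{u}).FullSubcategory

end ConnCat

namespace ConnCat

/-! ### The semigroup of cones -/

section Cones

variable {C : Type u} [Category.{v} C] [SubobjectCategory C]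

/-! The equivalence sends a category to its monoid of cones. The identity of this monoid is the cone
of inclusions into the largest object.

A CC-morphism `(F, G)` acts on cones: the image of `γ`, with vertex `z`, has vertex `F(z)`, lies in
the class `G(R_γ)`, and has component `F(γ(c))` at `F(c)`. It exists because `γ` is an idempotent
cone followed by an isomorphism (`CCHom.exists_maps`), and it is unique because a cone is fixed by
its vertex, its `ℛ`-class and one invertible component (`NormalCone.eq_of_mk_eq`). Monotonicity of
`G` makes the action multiplicative (`CCHom.Maps.star`).

Faithful: an epimorphism `f` out of `a` is visible in the cones `μ` and `μ ∗ f` with `μ(a) = 1`, and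
`G` in the `ℛ`-classes. Full: objects are vertices, and cones with the same vertex divide each other
on the left, so a homomorphism acts on objects; a morphism `f` is encoded by the cone `μ ∗ f°`.
Essentially surjective: a regular monoid `M` is the monoid of cones of its category of principal
left ideals, a cone corresponding to its component at `M` itself. -/

theorem SubLE.antisymm {a b : C} (h : SubLE a b) (h' : SubLE b a) : a = b := by
  obtain ⟨f, hf⟩ := h
  obtain ⟨g, hg⟩ := h'
  exact SubobjectCategory.incl_antisymm f g hf hg

theorem Cones.eq_mk_of_vertex_eq {γ : Cones C} {z : C} (h : γ.vertex = z) :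
    ∃ δ : NormalCone z, γ = ⟨z, δ⟩ := by
  subst h
  exact ⟨γ.cone, rfl⟩

variable [IsNormalCategory C]

theorem NormalCone.star_star {z w y : C} (γ : NormalCone z) (f : z ⟶ w) (g : w ⟶ y) [Epi f]
    [Epi g] : (γ.star f).star g = γ.star (f ≫ g) := by
  ext c
  simp [NormalCone.star]

theorem NormalCone.star_id {z : C} (γ : NormalCone z) : γ.star (𝟙 z) = γ := by
  ext c
  simp [NormalCone.star]

theorem NormalCone.star_congr {z w : C} (γ : NormalCone z) {f g : z ⟶ w} [Epi f] [Epi g]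
    (h : f = g) : γ.star f = γ.star g := by
  subst h
  rfl

/-- A cone with vertex `c` whose component at `c` is the identity. -/
noncomputable def idCone (c : C) : NormalCone c := (IsNormalCategory.exists_cone c).choose

@[simp]
theorem idCone_app (c : C) : (idCone c).app c = 𝟙 c := (IsNormalCategory.exists_cone c).choose_spec

/-- The cone `γ ∗ f°`. -/
noncomputable def Cones.act (γ : Cones C) {b : C} (f : γ.vertex ⟶ b) : Cones C :=
  ⟨im f, γ.cone.star (epiPart f)⟩

theorem Cones.mul_eq_act (γ δ : Cones C) : γ * δ = γ.act (δ.cone.app γ.vertex) := rfl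

/-- Any factorisation into an epimorphism and an inclusion computes the product, not only the chosen
normal one. -/
theorem Cones.act_eq (γ : Cones C) {w b : C} (p : γ.vertex ⟶ w) [Epi p] (j : w ⟶ b) (hj : Incl j) :
    γ.act (p ≫ j) = ⟨w, γ.cone.star p⟩ :=
  Cones.star_congr γ.cone _ _ (inclPart _) j (inclPart_incl _) hj (epiPart_inclPart _)

theorem Cones.act_comp_incl {z b d : C} (γ : NormalCone z) (f : z ⟶ b) (j : b ⟶ d) (hj : Incl j) :
    Cones.act ⟨z, γ⟩ (f ≫ j) = Cones.act ⟨z, γ⟩ f := by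
  have h := Cones.act_eq ⟨z, γ⟩ (epiPart f) (inclPart f ≫ j)
    (SubobjectCategory.incl_comp _ _ (inclPart_incl f) hj)
  rwa [← Category.assoc, epiPart_inclPart] at h

theorem Cones.act_star {z w b : C} (γ : NormalCone z) (p : z ⟶ w) [Epi p] (g : w ⟶ b) :
    Cones.act ⟨w, γ.star p⟩ g = Cones.act ⟨z, γ⟩ (p ≫ g) := by
  have h := Cones.act_eq ⟨z, γ⟩ (p ≫ epiPart g) (inclPart g) (inclPart_incl g)
  rw [Category.assoc, epiPart_inclPart] at h
  rw [h, ← NormalCone.star_star]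
  rfl

/-- `γ ∗ f` is `γ` times the cone `μ ∗ f` with `μ(z) = 1`, whose component at `z` is `f`. -/
theorem Cones.mk_star_le {z w : C} (γ : NormalCone z) (f : z ⟶ w) [Epi f] :
    RClasses.mk (⟨w, γ.star f⟩ : Cones C) ≤ RClasses.mk ⟨z, γ⟩ := by
  rw [RClasses.mk_le_mk]
  have h : ((idCone z).star f).app z = f := by simp [NormalCone.star]
  have : Epi ((⟨w, (idCone z).star f⟩ : Cones C).cone.app (⟨z, γ⟩ : Cones C).vertex) := by
    change Epi (((idCone z).star f).app z)
    rw [h]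
    infer_instance
  refine ⟨⟨w, (idCone z).star f⟩, ?_⟩
  rw [Cones.mul_of_epi, γ.star_congr h]

theorem Cones.mk_star_iso {z w : C} (γ : NormalCone z) (f : z ⟶ w) [IsIso f] :
    RClasses.mk (⟨w, γ.star f⟩ : Cones C) = RClasses.mk ⟨z, γ⟩ := by
  refine le_antisymm (Cones.mk_star_le γ f) ?_
  have h := Cones.mk_star_le (γ.star f) (inv f)
  rwa [NormalCone.star_star, γ.star_congr (IsIso.hom_inv_id f), NormalCone.star_id] at h

/-- Cancelling an invertible component makes it the identity without leaving the `ℛ`-class. -/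
theorem isIdempotentConeOf_star_inv {z c : C} (γ : NormalCone z) [IsIso (γ.app c)] :
    IsIdempotentConeOf (γ.star (inv (γ.app c))) (RClasses.mk (⟨z, γ⟩ : Cones C)) :=
  ⟨(isIdempotentElem_cone_iff _).2 (IsIso.hom_inv_id _), Cones.mk_star_iso _ _⟩

/-- A cone is determined by its vertex, its `ℛ`-class, and one invertible component. -/
theorem NormalCone.eq_of_mk_eq {z c : C} (γ δ : NormalCone z)
    (h : RClasses.mk (⟨z, γ⟩ : Cones C) = RClasses.mk ⟨z, δ⟩) [IsIso (γ.app c)]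
    (hc : γ.app c = δ.app c) : γ = δ := by
  have : IsIso (δ.app c) := hc ▸ inferInstance
  have h1 : γ.star (inv (γ.app c)) = δ.star (inv (δ.app c)) :=
    (isIdempotentConeOf_star_inv γ).unique (h ▸ isIdempotentConeOf_star_inv δ)
  ext x
  have h2 := congrArg (fun ε => NormalCone.app ε x) h1
  simp only [NormalCone.star] at h2
  rw [← cancel_mono (inv (γ.app c)), h2]
  congr 1
  simp only [hc]

theorem Cones.idem_app {ε : Cones C} (h : IsIdempotentElem ε) :
    ε.cone.app ε.vertex = 𝟙 ε.vertex :=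
  (isIdempotentElem_cone_iff ε.cone).1 h

/-- The vertex of a product is a subobject of the vertex of the right factor. -/
theorem Cones.subLE_of_mul_eq {α β γ : Cones C} (h : α * β = γ) : SubLE γ.vertex β.vertex := by
  subst h
  exact ⟨inclPart _, inclPart_incl _⟩

/-- The vertex of `γ` is a subobject of that of `β`, and the components of an idempotent cone at
subobjects of its vertex are the inclusions. -/
theorem Cones.incl_app_of_mul_eq {γ β : Cones C} (hβ : IsIdempotentElem β) (h : γ * β = γ) :
    Incl (β.cone.app γ.vertex) := by
  obtain ⟨j, hj⟩ := Cones.subLE_of_mul_eq h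
  rw [← β.cone.naturality j hj, Cones.idem_app hβ, Category.comp_id]
  exact hj

theorem Cones.mul_eq_left {γ : Cones C} {c : C} (j : γ.vertex ⟶ c) (hj : Incl j)
    {ε : NormalCone c} (hε : ε.app c = 𝟙 c) : γ * ⟨c, ε⟩ = γ := by
  have h : ε.app γ.vertex = 𝟙 _ ≫ j := by
    rw [← ε.naturality j hj, hε, Category.id_comp, Category.comp_id]
  rw [Cones.mul_eq_act]
  change γ.act (ε.app γ.vertex) = γ
  rw [h, Cones.act_eq _ _ j hj, NormalCone.star_id]

/-- Together with `Cones.mul_eq_left` this makes `γ` and the chosen idempotent cone at its vertex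
left multiples of each other, a relation that homomorphisms preserve. -/
theorem Cones.exists_mul_eq_idCone (γ : Cones C) : ∃ χ : Cones C, χ * γ = ⟨_, idCone γ.vertex⟩ := by
  obtain ⟨d, hd⟩ := γ.cone.exists_iso
  refine ⟨⟨d, (idCone γ.vertex).star (inv (γ.cone.app d))⟩, ?_⟩
  have : Epi (γ.cone.app (⟨d, (idCone γ.vertex).star (inv (γ.cone.app d))⟩ : Cones C).vertex) := by
    change Epi (γ.cone.app d)
    infer_instance
  rw [Cones.mul_of_epi]
  simp [NormalCone.star]

/-- The cone `μ ∗ f°`, where `μ` is the chosen idempotent cone at the domain of `f`. -/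
noncomputable def homCone {a b : C} (f : a ⟶ b) : Cones C := Cones.act ⟨a, idCone a⟩ f

theorem homCone_app {a x : C} (γ : NormalCone x) :
    homCone (γ.app a) = ⟨a, idCone a⟩ * ⟨x, γ⟩ := rfl

theorem homCone_of_incl {a b : C} (j : a ⟶ b) (hj : Incl j) : homCone j = ⟨a, idCone a⟩ := by
  have h := Cones.act_eq ⟨a, idCone a⟩ (𝟙 a) j hj
  rw [Category.id_comp, NormalCone.star_id] at h
  exact h

theorem homCone_mul_idCone {a b : C} (f : a ⟶ b) : homCone f * ⟨b, idCone b⟩ = homCone f :=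
  Cones.mul_eq_left (inclPart f) (inclPart_incl f) (idCone_app b)

theorem idCone_mul_idCone (a : C) :
    (⟨a, idCone a⟩ : Cones C) * ⟨a, idCone a⟩ = ⟨a, idCone a⟩ :=
  (isIdempotentElem_cone_iff _).2 (idCone_app a)

/-- This turns composition in the category into multiplication of cones, which a homomorphism
respects. -/
theorem homCone_comp {a b c : C} (f : a ⟶ b) (g : b ⟶ c) :
    homCone (f ≫ g) = homCone f * homCone g := by
  -- The chosen cone at `b` is the inclusion on the subobject `im f`.
  have h : ((idCone b).star (epiPart g)).app (im f) = inclPart f ≫ epiPart g := by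
    change (idCone b).app (im f) ≫ epiPart g = _
    rw [← (idCone b).naturality _ (inclPart_incl f), idCone_app, Category.comp_id]
  change _ = Cones.act ⟨im f, (idCone a).star (epiPart f)⟩
    (((idCone b).star (epiPart g)).app (im f))
  rw [h, Cones.act_star, ← Category.assoc, epiPart_inclPart,
    ← Cones.act_comp_incl _ _ _ (inclPart_incl g), Category.assoc, epiPart_inclPart]
  rfl

/-- The morphism from the vertex of `α` to the vertex of `β` induced by a cone `γ`. -/
def Cones.homOf (α γ β : Cones C) : α.vertex ⟶ β.vertex :=
  γ.cone.app α.vertex ≫ β.cone.app γ.vertex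

/-- Naturality of `β` along the inclusion of the image trades the epimorphic component for the whole
morphism. -/
theorem Cones.homOf_mul (α γ γ' β : Cones C) :
    Cones.homOf α (γ * γ') β =
      γ.cone.app α.vertex ≫ γ'.cone.app γ.vertex ≫ β.cone.app γ'.vertex := by
  change (γ.cone.app α.vertex ≫ epiPart (γ'.cone.app γ.vertex)) ≫ β.cone.app (im _) = _
  rw [← β.cone.naturality _ (inclPart_incl (γ'.cone.app γ.vertex)), Category.assoc,
    ← Category.assoc (epiPart _), epiPart_inclPart]

theorem Cones.homOf_mul_eq_comp {α β β' γ γ' : Cones C} (hβ : IsIdempotentElem β)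
    (h : γ * β = γ) : Cones.homOf α (γ * γ') β' = Cones.homOf α γ β ≫ Cones.homOf β γ' β' := by
  rw [Cones.homOf_mul, Cones.homOf, Cones.homOf,
    ← γ'.cone.naturality _ (Cones.incl_app_of_mul_eq hβ h)]
  simp only [Category.assoc]

/-- In a bounded above normal category, the cone of inclusions into the largest object is an
identity of the semigroup of cones. -/
theorem isRegularMonoid_cones (h : IsBoundedAbove C) : IsRegularMonoid (Cones C) := by
  obtain ⟨k, hk⟩ := h
  choose j hj using hk
  have hjk : j k = 𝟙 k := SubobjectCategory.incl_unique _ _ (hj k) (SubobjectCategory.incl_id k)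
  let ε : NormalCone k :=
    { app := j
      naturality := fun i hi => SubobjectCategory.incl_unique _ _
        (SubobjectCategory.incl_comp _ _ hi (hj _)) (hj _)
      exists_iso := ⟨k, by rw [hjk]; infer_instance⟩ }
  refine ⟨inferInstance, ⟨k, ε⟩, fun γ => ⟨?_, ?_⟩⟩
  · obtain ⟨d, hd⟩ := γ.cone.exists_iso
    have h1 := γ.cone.naturality (j d) (hj d)
    -- The invertible component at `d` factors through the component at `k`.
    have : Epi (γ.cone.app (⟨k, ε⟩ : Cones C).vertex) := by
      have : Epi (j d ≫ γ.cone.app k) := by rw [h1]; infer_instance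
      exact epi_of_epi (j d) _
    rw [Cones.mul_of_epi]
    obtain ⟨z, γ⟩ := γ
    congr 1
    ext c
    exact γ.naturality (j c) (hj c)
  · exact Cones.mul_eq_left (j γ.vertex) (hj _) hjk

end Cones

/-! ### The homomorphism of semigroups of cones induced by a CC-morphism -/

section Induced

variable {X Y Z : ConnectedCategory.{u}}

/-- Epimorphisms split in a normal category, so every functor preserves them. -/
theorem CCHom.map_epi (m : CCHom X Y) {a b : X.carrier} (f : a ⟶ b) [Epi f] : Epi (m.F.map f) := by
  obtain ⟨s, hs⟩ := exists_section_of_epi f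
  exact (SplitEpi.mk (m.F.map s) (by rw [← m.F.map_comp, hs, m.F.map_id])).epi

/-- The cone `δ` corresponds to the cone `γ` under the CC-morphism `m`. -/
structure CCHom.Maps (m : CCHom X Y) (γ : Cones X.carrier)
    (δ : NormalCone (m.F.obj γ.vertex)) : Prop where
  mk_eq : ∀ h : RClasses.mk γ ∈ X.downSet, RClasses.mk ⟨_, δ⟩ = (m.G ⟨RClasses.mk γ, h⟩).1
  app_eq : ∀ c : X.carrier, δ.app (m.F.obj c) = m.F.map (γ.cone.app c)

theorem CCHom.Maps.unique {m : CCHom X Y} {γ : Cones X.carrier} (hγ : RClasses.mk γ ∈ X.downSet)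
    {δ δ' : NormalCone (m.F.obj γ.vertex)} (h : m.Maps γ δ) (h' : m.Maps γ δ') : δ = δ' := by
  obtain ⟨c, hc⟩ := γ.cone.exists_iso
  have : IsIso (δ.app (m.F.obj c)) := by rw [h.app_eq]; infer_instance
  exact δ.eq_of_mk_eq δ' ((h.mk_eq hγ).trans (h'.mk_eq hγ).symm)
    ((h.app_eq c).trans (h'.app_eq c).symm)

/-- With `γ(c)` invertible, `γ = ε(c, 𝔡) ∗ γ(c)` for `𝔡` the class of `γ`; the image is `ε(F(c),
G(𝔡)) ∗ F(γ(c))`. -/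
theorem CCHom.exists_maps (m : CCHom X Y) (γ : Cones X.carrier) (hγ : RClasses.mk γ ∈ X.downSet) :
    ∃ δ, m.Maps γ δ := by
  obtain ⟨z, γ⟩ := γ
  obtain ⟨c, hc⟩ := γ.exists_iso
  have hε := isIdempotentConeOf_star_inv (c := c) γ
  obtain ⟨ε', hε'⟩ := m.map_connected c ⟨_, hγ⟩ ⟨_, hε⟩
  refine ⟨ε'.star (m.F.map (γ.app c)), fun _ => ?_, fun c' => ?_⟩
  · rw [Cones.mk_star_iso]
    exact hε'.2
  · change ε'.app _ ≫ m.F.map (γ.app c) = m.F.map (γ.app c')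
    rw [← m.map_cone c ⟨_, hγ⟩ _ ε' hε hε' c', ← m.F.map_comp]
    simp [NormalCone.star]

theorem CCHom.Maps.id (γ : Cones X.carrier) : (CCHom.id X).Maps γ γ.cone :=
  ⟨fun _ => rfl, fun _ => rfl⟩

theorem CCHom.Maps.comp {m : CCHom X Y} {n : CCHom Y Z} {γ : Cones X.carrier}
    (hγ : RClasses.mk γ ∈ X.downSet) {δ : NormalCone (m.F.obj γ.vertex)}
    {η : NormalCone (n.F.obj (m.F.obj γ.vertex))} (h : m.Maps γ δ) (h' : n.Maps ⟨_, δ⟩ η) :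
    (m.comp n).Maps γ η := by
  have e := h.mk_eq hγ
  refine ⟨fun _ => ?_, fun c => ?_⟩
  · have hδ : RClasses.mk (⟨_, δ⟩ : Cones Y.carrier) ∈ Y.downSet := e ▸ (m.G _).2
    refine (h'.mk_eq hδ).trans ?_
    exact congrArg (fun d => (n.G d).1) (Subtype.ext e)
  · refine (h'.app_eq _).trans ?_
    exact congrArg n.F.map (h.app_eq c)

theorem RClasses.mk_surjective {S : Type u} [Semigroup S] [IsRegularSemigroup S] :
    Function.Surjective (RClasses.mk : S → RClasses S) := Quot.mk_surjective

/-- `ε * α = α` when the idempotent cone `ε` is `ℛ`-above `α`. -/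
theorem idem_mul_of_mk_le {S : Type u} [Semigroup S] [IsRegularSemigroup S] {e a : S}
    (he : IsIdempotentElem e) (h : RClasses.mk a ≤ RClasses.mk e) : e * a = a := by
  obtain ⟨x, rfl⟩ := (RClasses.mk_le_mk a e).1 h
  rw [← mul_assoc, he]

/-- Since `G` is order preserving, the image `α` of `γ ∗ f` lies `ℛ`-below `δ`, and this forces `α`
to be `δ` followed by a morphism. -/
theorem CCHom.Maps.star {m : CCHom X Y} {γ : Cones X.carrier} {w : X.carrier}
    (hγ : RClasses.mk γ ∈ X.downSet) {δ : NormalCone (m.F.obj γ.vertex)}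
    (h : m.Maps γ δ) (f : γ.vertex ⟶ w) [Epi f] [Epi (m.F.map f)] :
    m.Maps ⟨w, γ.cone.star f⟩ (δ.star (m.F.map f)) := by
  have hle : RClasses.mk (⟨w, γ.cone.star f⟩ : Cones X.carrier) ≤ RClasses.mk γ :=
    Cones.mk_star_le γ.cone f
  have hα : RClasses.mk (⟨w, γ.cone.star f⟩ : Cones X.carrier) ∈ X.downSet :=
    X.downSet.lower hle hγ
  obtain ⟨α, hm⟩ := m.exists_maps ⟨w, γ.cone.star f⟩ hα
  suffices hs : δ.star (m.F.map f) = α by rw [hs]; exact hm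
  obtain ⟨c, hc⟩ := γ.cone.exists_iso
  have hi : IsIso (δ.app (m.F.obj c)) := by rw [h.app_eq]; infer_instance
  have hle' : RClasses.mk (⟨_, α⟩ : Cones Y.carrier) ≤ RClasses.mk ⟨_, δ⟩ := by
    rw [hm.mk_eq hα, h.mk_eq hγ]
    exact m.G.monotone hle
  have hε := isIdempotentConeOf_star_inv (c := m.F.obj c) δ
  -- The idempotent cone in the class of `δ` is a left identity for `α`, so `α` is that cone
  -- followed by its own component at `F(c)`.
  have hmul := idem_mul_of_mk_le hε.1 (hle'.trans_eq hε.2.symm)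
  have happ : α.app (m.F.obj c) = δ.app (m.F.obj c) ≫ m.F.map f := by
    rw [hm.app_eq, h.app_eq, ← m.F.map_comp]
    rfl
  have : Epi (α.app (m.F.obj c)) := by
    rw [happ]
    infer_instance
  have hmul' := Cones.mul_of_epi ⟨_, δ.star (inv (δ.app (m.F.obj c)))⟩ ⟨_, α⟩
  rw [hmul] at hmul'
  have h2 := eq_of_heq ((Cones.mk.injEq ..).mp hmul').2
  rw [h2, NormalCone.star_star]
  refine NormalCone.star_congr _ ?_
  change m.F.map f = _ ≫ α.app (m.F.obj c)
  rw [happ, IsIso.inv_hom_id_assoc]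

/-- `F` takes an epimorphism followed by an inclusion to another such factorisation, so `F(f°)` may
serve as the epimorphic component of `F(f)`. -/
theorem CCHom.Maps.mul {m : CCHom X Y} {γ γ' : Cones X.carrier}
    (hγ : RClasses.mk γ ∈ X.downSet) {δ : NormalCone (m.F.obj γ.vertex)}
    {δ' : NormalCone (m.F.obj γ'.vertex)} {η : NormalCone (m.F.obj (γ * γ').vertex)}
    (h : m.Maps γ δ) (h' : m.Maps γ' δ') (hη : m.Maps (γ * γ') η) :
    (⟨_, η⟩ : Cones Y.carrier) = ⟨_, δ⟩ * ⟨_, δ'⟩ := by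
  have hγγ' : RClasses.mk (γ * γ') ∈ X.downSet :=
    X.downSet.lower ((RClasses.mk_le_mk _ γ).2 ⟨γ', rfl⟩) hγ
  have := m.map_epi (epiPart (γ'.cone.app γ.vertex))
  have e := hη.unique hγγ' (h.star hγ (epiPart (γ'.cone.app γ.vertex)))
  have hf : δ'.app (m.F.obj γ.vertex) = m.F.map (epiPart (γ'.cone.app γ.vertex)) ≫
      m.F.map (inclPart (γ'.cone.app γ.vertex)) := by
    rw [h'.app_eq, ← m.F.map_comp, epiPart_inclPart]
  subst e
  symm
  change Cones.act ⟨_, δ⟩ (δ'.app _) = _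
  rw [hf, Cones.act_eq _ _ _ (m.map_incl _ (inclPart_incl _))]
  rfl

theorem ConnectedCategory.mem_downSet (hX : X.downSet = ⊤) (d : RClasses (Cones X.carrier)) :
    d ∈ X.downSet := by
  rw [hX]
  trivial

/-- The homomorphism of semigroups of cones induced by a CC-morphism. -/
noncomputable def CCHom.onCones (m : CCHom X Y) (hX : X.downSet = ⊤) :
    Cones X.carrier →ₙ* Cones Y.carrier where
  toFun γ := ⟨_, (m.exists_maps γ (X.mem_downSet hX _)).choose⟩
  map_mul' γ γ' :=
    (m.exists_maps γ (X.mem_downSet hX _)).choose_spec.mul (X.mem_downSet hX _)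
      (m.exists_maps γ' (X.mem_downSet hX _)).choose_spec
      (m.exists_maps (γ * γ') (X.mem_downSet hX _)).choose_spec

theorem CCHom.Maps.onCones_eq {m : CCHom X Y} (hX : X.downSet = ⊤) {γ : Cones X.carrier}
    {δ : NormalCone (m.F.obj γ.vertex)} (h : m.Maps γ δ) : m.onCones hX γ = ⟨_, δ⟩ :=
  congrArg (Cones.mk _)
    ((m.exists_maps γ (X.mem_downSet hX _)).choose_spec.unique (X.mem_downSet hX _) h)

theorem CCHom.mk_onCones (m : CCHom X Y) (hX : X.downSet = ⊤) (γ : Cones X.carrier) :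
    RClasses.mk (m.onCones hX γ) = (m.G ⟨RClasses.mk γ, X.mem_downSet hX _⟩).1 := by
  obtain ⟨δ, h⟩ := m.exists_maps γ (X.mem_downSet hX _)
  rw [h.onCones_eq hX, h.mk_eq]

/-- A morphism is determined by the two cones `ε` and `ε ∗ f`, where `ε` is idempotent. -/
theorem heq_of_star_eq {C : Type u} [Category.{v} C] [SubobjectCategory C] [IsNormalCategory C]
    {a a' b b' : C} {ε : NormalCone a} {ε' : NormalCone a'} (f : a ⟶ b) (f' : a' ⟶ b')
    [Epi f] [Epi f'] (hε : ε.app a = 𝟙 a) (h : (⟨a, ε⟩ : Cones C) = ⟨a', ε'⟩)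
    (h' : (⟨b, ε.star f⟩ : Cones C) = ⟨b', ε'.star f'⟩) : HEq f f' := by
  obtain ⟨rfl, e⟩ := (Cones.mk.injEq ..).mp h
  obtain rfl := eq_of_heq e
  obtain ⟨rfl, e'⟩ := (Cones.mk.injEq ..).mp h'
  have e2 : ε.app a ≫ f = ε.app a ≫ f' :=
    congrArg (fun γ => NormalCone.app γ a) (eq_of_heq e')
  rw [hε, Category.id_comp, Category.id_comp] at e2
  exact heq_of_eq e2

theorem heq_comp_incl {C : Type u} [Category.{v} C] [SubobjectCategory C]
    {a a' b b' c c' : C} {f : a ⟶ b} {f' : a' ⟶ b'} {j : b ⟶ c} {j' : b' ⟶ c'}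
    (ha : a = a') (hb : b = b') (hc : c = c') (hf : HEq f f') (hj : Incl j) (hj' : Incl j') :
    HEq (f ≫ j) (f' ≫ j') := by
  subst ha hb hc
  obtain rfl := eq_of_heq hf
  obtain rfl := SubobjectCategory.incl_unique j j' hj hj'
  rfl

/-- Epimorphisms are recovered from pairs of cones; inclusions are determined by their endpoints, so
the factorisation of `f` gives the rest of the functor. -/
theorem CCHom.onCones_injective (hX : X.downSet = ⊤) {m n : CCHom X Y}
    (h : m.onCones hX = n.onCones hX) : m = n := by
  have hobj : ∀ c, m.F.obj c = n.F.obj c := fun c =>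
    congrArg (fun f : Cones X.carrier →ₙ* Cones Y.carrier => (f ⟨c, idCone c⟩).vertex) h
  have hepi : ∀ {a b : X.carrier} (f : a ⟶ b) [Epi f], HEq (m.F.map f) (n.F.map f) := by
    intro a b f _
    obtain ⟨δ, hδ⟩ := m.exists_maps ⟨a, idCone a⟩ (X.mem_downSet hX _)
    obtain ⟨δ', hδ'⟩ := n.exists_maps ⟨a, idCone a⟩ (X.mem_downSet hX _)
    have := m.map_epi f
    have := n.map_epi f
    have h1 := DFunLike.congr_fun h ⟨a, idCone a⟩
    have h2 := DFunLike.congr_fun h ⟨b, (idCone a).star f⟩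
    rw [hδ.onCones_eq, hδ'.onCones_eq] at h1
    have hs := (hδ.star (X.mem_downSet hX _) f).onCones_eq hX
    have hs' := (hδ'.star (X.mem_downSet hX _) f).onCones_eq hX
    refine heq_of_star_eq (ε := δ) (ε' := δ') _ _ ?_ h1 (hs.symm.trans (h2.trans hs'))
    have := hδ.app_eq a
    rw [idCone_app, m.F.map_id] at this
    exact this
  refine CCHom.ext (CategoryTheory.Functor.hext hobj fun a b f => ?_) ?_
  · rw [← epiPart_inclPart f, m.F.map_comp, n.F.map_comp]
    exact heq_comp_incl (hobj _) (hobj _) (hobj _) (hepi _) (m.map_incl _ (inclPart_incl f))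
      (n.map_incl _ (inclPart_incl f))
  · ext d
    obtain ⟨d, hd⟩ := d
    obtain ⟨γ, rfl⟩ := RClasses.mk_surjective d
    rw [← m.mk_onCones hX, ← n.mk_onCones hX, h]

/-! ### Every homomorphism of semigroups of cones is induced by a CC-morphism -/

/-- Cones that are left multiples of each other have vertices that are subobjects of each other,
hence equal. -/
theorem vertex_map_eq {γ : Cones X.carrier} (h : Cones X.carrier →ₙ* Cones Y.carrier) :
    (h γ).vertex = (h ⟨_, idCone γ.vertex⟩).vertex := by
  obtain ⟨χ, hχ⟩ := γ.exists_mul_eq_idCone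
  have h1 : γ * ⟨_, idCone γ.vertex⟩ = γ :=
    Cones.mul_eq_left (𝟙 _) (SubobjectCategory.incl_id _) (idCone_app _)
  refine SubLE.antisymm (Cones.subLE_of_mul_eq (α := h γ) ?_)
    (Cones.subLE_of_mul_eq (α := h χ) ?_)
  · rw [← map_mul, h1]
  · rw [← map_mul, hχ]

theorem isIdempotentElem_map_idCone (h : Cones X.carrier →ₙ* Cones Y.carrier) (c : X.carrier) :
    IsIdempotentElem (h ⟨c, idCone c⟩) := by
  rw [IsIdempotentElem, ← map_mul, idCone_mul_idCone]

/-- The functor induced by a homomorphism of semigroups of cones. -/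
noncomputable def functorOfHom (h : Cones X.carrier →ₙ* Cones Y.carrier) :
    X.carrier ⥤ Y.carrier where
  obj c := (h ⟨c, idCone c⟩).vertex
  map {a b} f := Cones.homOf (h ⟨a, idCone a⟩) (h (homCone f)) (h ⟨b, idCone b⟩)
  map_id a := by
    rw [homCone_of_incl (𝟙 a) (SubobjectCategory.incl_id a), Cones.homOf,
      Cones.idem_app (isIdempotentElem_map_idCone h a), Category.comp_id]
  map_comp {a b c} f g := by
    rw [homCone_comp, map_mul]
    exact Cones.homOf_mul_eq_comp (isIdempotentElem_map_idCone h b)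
      (by rw [← map_mul, homCone_mul_idCone])

/-- The morphism `γ(c)` is encoded by the product of the chosen cone at `c` with `γ`; under `h` the
idempotent factors contribute identities only. -/
theorem functorOfHom_map_app (h : Cones X.carrier →ₙ* Cones Y.carrier) {z : X.carrier}
    (γ : NormalCone z) {δ : NormalCone ((functorOfHom h).obj z)} (hδ : h ⟨z, γ⟩ = ⟨_, δ⟩)
    (c : X.carrier) : (functorOfHom h).map (γ.app c) = δ.app ((functorOfHom h).obj c) := by
  change Cones.homOf (h ⟨c, idCone c⟩) (h (homCone (γ.app c))) (h ⟨z, idCone z⟩) = _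
  rw [homCone_app, map_mul, Cones.homOf_mul, Cones.idem_app (isIdempotentElem_map_idCone h c),
    Category.id_comp, hδ]
  exact (congrArg (δ.app ((functorOfHom h).obj c) ≫ ·)
    (Cones.idem_app (isIdempotentElem_map_idCone h z))).trans (Category.comp_id _)

theorem mk_map_mono {S T : Type u} [Semigroup S] [IsRegularSemigroup S] [Semigroup T]
    [IsRegularSemigroup T] (h : S →ₙ* T) {a b : S} (hab : RClasses.mk a ≤ RClasses.mk b) :
    RClasses.mk (h a) ≤ RClasses.mk (h b) := by
  obtain ⟨x, rfl⟩ := (RClasses.mk_le_mk a b).1 hab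
  exact (RClasses.mk_le_mk _ _).2 ⟨h x, map_mul h b x⟩

/-- The order preserving map of `ℛ`-classes induced by a homomorphism. -/
noncomputable def rClassesMap {S T : Type u} [Semigroup S] [IsRegularSemigroup S] [Semigroup T]
    [IsRegularSemigroup T] (h : S →ₙ* T) : RClasses S →o RClasses T where
  toFun d := RClasses.mk (h (RClasses.mk_surjective d).choose)
  monotone' d d' hd := mk_map_mono h
    (((RClasses.mk_surjective d).choose_spec.trans_le hd).trans_eq
      (RClasses.mk_surjective d').choose_spec.symm)

theorem rClassesMap_mk {S T : Type u} [Semigroup S] [IsRegularSemigroup S] [Semigroup T]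
    [IsRegularSemigroup T] (h : S →ₙ* T) (a : S) :
    rClassesMap h (RClasses.mk a) = RClasses.mk (h a) :=
  le_antisymm (mk_map_mono h (RClasses.mk_surjective (RClasses.mk a)).choose_spec.le)
    (mk_map_mono h (RClasses.mk_surjective (RClasses.mk a)).choose_spec.ge)

/-- The CC-morphism induced by a homomorphism of semigroups of cones. -/
noncomputable def ccHomOfHom (hY : Y.downSet = ⊤) (h : Cones X.carrier →ₙ* Cones Y.carrier) :
    CCHom X Y where
  F := functorOfHom h
  G :=
    { toFun := fun d => ⟨rClassesMap h d.1, Y.mem_downSet hY _⟩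
      monotone' := fun _ _ hd => (rClassesMap h).monotone hd }
  map_incl {a b} j hj := by
    change Incl (Cones.homOf _ _ _)
    rw [homCone_of_incl j hj, Cones.homOf, Cones.idem_app (isIdempotentElem_map_idCone h a),
      Category.id_comp]
    exact Cones.incl_app_of_mul_eq (isIdempotentElem_map_idCone h b)
      (by rw [← map_mul, Cones.mul_eq_left (γ := ⟨a, idCone a⟩) j hj (idCone_app b)])
  map_connected c d hc := by
    obtain ⟨ε, hε, hd⟩ := hc
    obtain ⟨δ, hδ⟩ := Cones.eq_mk_of_vertex_eq (vertex_map_eq (γ := ⟨c, ε⟩) h)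
    refine ⟨δ, ?_, ?_⟩
    · change IsIdempotentElem (Cones.mk (h ⟨c, idCone c⟩).vertex δ)
      rw [← hδ, IsIdempotentElem, ← map_mul, hε]
    · change RClasses.mk (Cones.mk (h ⟨c, idCone c⟩).vertex δ) = rClassesMap h d.1
      rw [← hδ, ← hd, rClassesMap_mk]
  map_cone c d ε ε' hε hε' c' := by
    obtain ⟨δ, hδ⟩ := Cones.eq_mk_of_vertex_eq (vertex_map_eq (γ := ⟨c, ε⟩) h)
    have hδ' : IsIdempotentConeOf (c := (functorOfHom h).obj c) δ (rClassesMap h d.1) := by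
      refine ⟨?_, ?_⟩
      · change IsIdempotentElem (Cones.mk (h ⟨c, idCone c⟩).vertex δ)
        rw [← hδ, IsIdempotentElem, ← map_mul, hε.1]
      · change RClasses.mk (Cones.mk (h ⟨c, idCone c⟩).vertex δ) = rClassesMap h d.1
        rw [← hδ, ← hε.2, rClassesMap_mk]
    -- The image of `ε` under `h` is the idempotent cone prescribed by the CC-condition.
    obtain rfl := hδ'.unique hε'
    exact functorOfHom_map_app h ε hδ c'

/-- The cone `h γ` has the vertex, class and components that characterise the image of `γ`. -/
theorem onCones_ccHomOfHom (hX : X.downSet = ⊤) (hY : Y.downSet = ⊤)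
    (h : Cones X.carrier →ₙ* Cones Y.carrier) : (ccHomOfHom hY h).onCones hX = h := by
  ext γ : 1
  obtain ⟨δ, hδ⟩ := Cones.eq_mk_of_vertex_eq (vertex_map_eq (γ := γ) h)
  have hm : (ccHomOfHom hY h).Maps γ δ := by
    refine ⟨fun _ => ?_, fun c => (functorOfHom_map_app h γ.cone hδ c).symm⟩
    change RClasses.mk (Cones.mk (h ⟨_, idCone γ.vertex⟩).vertex δ) = rClassesMap h _
    rw [← hδ, rClassesMap_mk]
  exact (hm.onCones_eq hX).trans hδ.symm

/-- The functor sending a bounded above normal category to its monoid of cones. -/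
noncomputable def conesFunctor : BoundedAboveNormalCategory.{u} ⥤ RegularMonoid.{u} where
  obj X := ⟨Semigrp.of (Cones X.obj.carrier), isRegularMonoid_cones X.property.2⟩
  map {X _} m := ObjectProperty.homMk (Semigrp.ofHom (CCHom.onCones m.hom X.property.1))
  map_id X := by
    apply ObjectProperty.hom_ext
    ext γ
    exact (CCHom.Maps.id γ).onCones_eq X.property.1
  map_comp {X Y Z} m n := by
    apply ObjectProperty.hom_ext
    ext γ
    have hX := X.property.1
    obtain ⟨δ, hδ⟩ := CCHom.exists_maps m.hom γ (X.obj.mem_downSet hX _)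
    obtain ⟨η, hη⟩ := CCHom.exists_maps n.hom ⟨_, δ⟩ (Y.obj.mem_downSet Y.property.1 _)
    refine ((hδ.comp (X.obj.mem_downSet hX _) hη).onCones_eq hX).trans ?_
    change _ = CCHom.onCones n.hom Y.property.1 (CCHom.onCones m.hom hX γ)
    rw [hδ.onCones_eq, hη.onCones_eq]
    rfl

instance : conesFunctor.{u}.Faithful where
  map_injective {X _ m n} h := by
    apply ObjectProperty.hom_ext
    refine CCHom.onCones_injective X.property.1 ?_
    exact congrArg (fun f => Semigrp.Hom.hom f.hom) h

instance : conesFunctor.{u}.Full where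
  map_surjective {X Y} h := by
    refine ⟨ObjectProperty.homMk (ccHomOfHom Y.property.1 h.hom.hom), ?_⟩
    apply ObjectProperty.hom_ext
    exact congrArg Semigrp.ofHom (onCones_ccHomOfHom X.property.1 Y.property.1 h.hom.hom)

end Induced

/-! ### The category of principal left ideals of a regular monoid -/

section LeftIdeals

variable {M : Type u} [Semigroup M]

/-- Two idempotents are `ℒ`-related. -/
def idempotentSetoid (M : Type u) [Semigroup M] : Setoid {e : M // IsIdempotentElem e} where
  r e f := e.1 * f.1 = e.1 ∧ f.1 * e.1 = f.1
  iseqv :=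
    { refl := fun e => ⟨e.2, e.2⟩
      symm := fun h => ⟨h.2, h.1⟩
      trans := fun {e f g} h h' =>
        ⟨by rw [← h.1, mul_assoc, h'.1], by rw [← h'.2, mul_assoc, h.2]⟩ }

variable (M) in
/-- The principal left ideals of a regular semigroup, as `ℒ`-classes of idempotents. -/
def LeftIdeal : Type u := Quotient (idempotentSetoid M)

namespace LeftIdeal

/-- A chosen idempotent generator. -/
noncomputable def gen (x : LeftIdeal M) : M := (Quotient.out x).1

theorem gen_mul_gen (x : LeftIdeal M) : x.gen * x.gen = x.gen := (Quotient.out x).2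

theorem gen_injective {x y : LeftIdeal M} (h : x.gen * y.gen = x.gen) (h' : y.gen * x.gen = y.gen) :
    x = y := by
  rw [← Quotient.out_eq x, ← Quotient.out_eq y]
  exact Quotient.sound ⟨h, h'⟩

theorem exists_gen_of_idem {e : M} (he : IsIdempotentElem e) :
    ∃ x : LeftIdeal M, x.gen * e = x.gen ∧ e * x.gen = e :=
  ⟨Quotient.mk (idempotentSetoid M) ⟨e, he⟩,
    Quotient.exact (s := idempotentSetoid M)
      (Quotient.out_eq (Quotient.mk (idempotentSetoid M) ⟨e, he⟩))⟩

/-- An idempotent `ℒ`-related to the identity equals it, so the chosen generator is the identity. -/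
theorem exists_top {e : M} (he : ∀ a : M, e * a = a ∧ a * e = a) :
    ∃ k : LeftIdeal M, ∀ a : M, k.gen * a = a ∧ a * k.gen = a := by
  obtain ⟨k, -, h⟩ := exists_gen_of_idem (he e).1
  rw [(he k.gen).1] at h
  exact ⟨k, h ▸ he⟩

/-- A morphism `Me ⟶ Mf` is right translation by an element of `eMf`. -/
@[ext]
structure Hom (x y : LeftIdeal M) where
  val : M
  gen_mul : x.gen * val = val
  mul_gen : val * y.gen = val

noncomputable instance : SmallCategory (LeftIdeal M) where
  Hom := Hom
  id x := ⟨x.gen, x.gen_mul_gen, x.gen_mul_gen⟩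
  comp f g := ⟨f.val * g.val, by rw [← mul_assoc, f.gen_mul], by rw [mul_assoc, g.mul_gen]⟩
  id_comp f := Hom.ext f.gen_mul
  comp_id f := Hom.ext f.mul_gen
  assoc _ _ _ := Hom.ext (mul_assoc _ _ _)

/-- The element representing a morphism. -/
def elt {x y : LeftIdeal M} (f : x ⟶ y) : M := Hom.val f

/-- The morphism represented by an element. -/
def ofElt {x y : LeftIdeal M} (a : M) (h : x.gen * a = a) (h' : a * y.gen = a) : x ⟶ y :=
  Hom.mk a h h'

theorem elt_ofElt {x y : LeftIdeal M} (a : M) (h : x.gen * a = a) (h' : a * y.gen = a) :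
    elt (ofElt a h h' : x ⟶ y) = a := rfl

theorem elt_id (x : LeftIdeal M) : elt (𝟙 x) = x.gen := rfl

theorem elt_comp {x y z : LeftIdeal M} (f : x ⟶ y) (g : y ⟶ z) : elt (f ≫ g) = elt f * elt g := rfl

theorem gen_mul_elt {x y : LeftIdeal M} (f : x ⟶ y) : x.gen * elt f = elt f := Hom.gen_mul f

theorem elt_mul_gen {x y : LeftIdeal M} (f : x ⟶ y) : elt f * y.gen = elt f := Hom.mul_gen f

theorem hom_ext {x y : LeftIdeal M} {f g : x ⟶ y} (h : elt f = elt g) : f = g := Hom.ext h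

/-- An inclusion of left ideals fixes every element, so it is right translation by the generator of
the smaller ideal. -/
noncomputable instance : SubobjectCategory (LeftIdeal M) where
  incl {x _} f := elt f = x.gen
  incl_id _ := rfl
  incl_comp {x y _} f g hf hg := by
    rw [elt_comp, hg, elt_mul_gen, hf]
  incl_unique f g hf hg := hom_ext (hf.trans hg.symm)
  incl_antisymm {x y} f g hf hg :=
    gen_injective (by rw [← hf, elt_mul_gen]) (by rw [← hg, elt_mul_gen])
  incl_mono {x y} f hf := ⟨fun g h e => hom_ext (by
    have := congrArg elt e
    rwa [elt_comp, elt_comp, hf, elt_mul_gen, elt_mul_gen] at this)⟩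
  incl_of_comp {x y z} h g hg hhg := by
    rwa [elt_comp, hg, elt_mul_gen] at hhg

theorem incl_iff {x y : LeftIdeal M} (f : x ⟶ y) : Incl f ↔ elt f = x.gen := Iff.rfl

/-- The cone of right translations by the generator of `z`. -/
noncomputable def translationCone (z : LeftIdeal M) : NormalCone z where
  app x := ofElt (x.gen * z.gen) (by rw [← mul_assoc, gen_mul_gen]) (by rw [mul_assoc, gen_mul_gen])
  naturality {x y} j hj := hom_ext (by
    rw [elt_comp, elt_ofElt, elt_ofElt, ← mul_assoc, elt_mul_gen, hj])
  exists_iso := ⟨z, by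
    have : (ofElt (z.gen * z.gen) (by rw [← mul_assoc, gen_mul_gen, gen_mul_gen])
        (by rw [mul_assoc, gen_mul_gen, gen_mul_gen]) : z ⟶ z) = 𝟙 z := hom_ext z.gen_mul_gen
    rw [this]
    infer_instance⟩

/-- Every element of a regular semigroup generates the same left ideal as some generator. -/
theorem exists_gen [IsRegularSemigroup M] (a : M) :
    ∃ (z : LeftIdeal M) (b : M), a * z.gen = a ∧ b * a = z.gen ∧ z.gen * b = b ∧ a * b * a = a := by
  obtain ⟨b, hb, -⟩ := IsRegularSemigroup.exists_inverse a
  have he : IsIdempotentElem (b * a) := by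
    rw [IsIdempotentElem, mul_assoc, ← mul_assoc a b a, hb]
  obtain ⟨z, h1, h2⟩ := exists_gen_of_idem he
  have h3 : a * z.gen = a := by
    calc a * z.gen = a * (b * a * z.gen) := by rw [← mul_assoc, ← mul_assoc, hb]
      _ = a := by rw [h2, ← mul_assoc, hb]
  -- The factor `z.gen` makes `b` a morphism out of `z`, and `a * z.gen = a` keeps the identities
  -- for `b`.
  refine ⟨z, z.gen * b, h3, by rw [mul_assoc, h1], by rw [← mul_assoc, gen_mul_gen], ?_⟩
  rw [← mul_assoc, h3, hb]

/-- Let `a` represent `f : Me ⟶ Mf'` and let `ba` be the generator of `Ma`. The idempotent `abe`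
retracts `Me` onto `Mabe`, which `a` maps isomorphically onto `Ma` with inverse `b(abe)`; then `Ma`
is included in `Mf'`. -/
instance [IsRegularSemigroup M] : IsNormalCategory (LeftIdeal M) where
  splits {x y} j hj := by
    have h : x.gen * y.gen = x.gen := by rw [← (incl_iff j).1 hj, elt_mul_gen]
    refine ⟨ofElt (y.gen * x.gen) (by rw [← mul_assoc, gen_mul_gen])
      (by rw [mul_assoc, gen_mul_gen]), hom_ext ?_⟩
    rw [elt_comp, (incl_iff j).1 hj, elt_ofElt, ← mul_assoc, h, gen_mul_gen, elt_id]
  exists_normalFactorisation {x y} f := by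
    obtain ⟨z, b, h1, h2, h3, h4⟩ := exists_gen (elt f)
    have hx := gen_mul_elt f
    have hy := elt_mul_gen f
    have hzy : z.gen * y.gen = z.gen := by rw [← h2, mul_assoc, hy]
    have hgf : elt f * b * x.gen * elt f = elt f := by rw [mul_assoc, hx, h4]
    have hg : IsIdempotentElem (elt f * b * x.gen) := by
      rw [IsIdempotentElem, ← mul_assoc, ← mul_assoc, hgf]
    obtain ⟨w, hw1, hw2⟩ := exists_gen_of_idem hg
    have hxg : x.gen * (elt f * b * x.gen) = elt f * b * x.gen := by
      rw [← mul_assoc, ← mul_assoc, hx]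
    have hwx : w.gen * x.gen = w.gen := by
      rw [← hw1, mul_assoc, mul_assoc _ x.gen x.gen, gen_mul_gen]
    let u : w ⟶ z := ofElt (w.gen * elt f) (by rw [← mul_assoc, gen_mul_gen]) (by rw [mul_assoc, h1])
    let v : z ⟶ w := ofElt (b * (elt f * b * x.gen)) (by rw [← mul_assoc, h3])
      (by rw [mul_assoc, hw2])
    have huv : u ≫ v = 𝟙 w := hom_ext (by
      change w.gen * elt f * (b * (elt f * b * x.gen)) = w.gen
      calc _ = w.gen * (elt f * b * elt f * b * x.gen) := by simp only [mul_assoc]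
        _ = w.gen := by rw [h4, hw1])
    have hvu : v ≫ u = 𝟙 z := hom_ext (by
      change b * (elt f * b * x.gen) * (w.gen * elt f) = z.gen
      rw [← mul_assoc, mul_assoc b, hw2, mul_assoc, hgf, h2])
    exact ⟨{
      coim := w
      im := z
      q := ofElt (elt f * b * x.gen) hxg hw2
      u := u
      j := ofElt z.gen z.gen_mul_gen hzy
      retraction := ⟨ofElt w.gen w.gen_mul_gen hwx, rfl, hom_ext hw1⟩
      iso := ⟨v, huv, hvu⟩
      inclusion := rfl
      fac := hom_ext (by
        change elt f * b * x.gen * (w.gen * elt f * z.gen) = elt f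
        rw [mul_assoc w.gen, h1, ← mul_assoc, hw2, hgf]) }⟩
  exists_cone z := ⟨translationCone z, hom_ext z.gen_mul_gen⟩

/-! ### Cones on the left ideals of a monoid -/

variable {k : LeftIdeal M}

/-- The inclusion into the largest object. -/
noncomputable def toTop (hk : ∀ a : M, k.gen * a = a ∧ a * k.gen = a)
    (x : LeftIdeal M) : x ⟶ k := ofElt x.gen x.gen_mul_gen (hk _).2

theorem app_eq_toTop (hk : ∀ a : M, k.gen * a = a ∧ a * k.gen = a)
    {z : LeftIdeal M} (γ : NormalCone z) (x : LeftIdeal M) :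
    elt (γ.app x) = x.gen * elt (γ.app k) := by
  rw [← γ.naturality (toTop hk x) rfl]
  rfl

/-- An invertible component writes the generator of the vertex of `γ` as a left multiple of the
element at `k`, which the vertex of `δ` fixes on the right. -/
theorem gen_vertex_mul_gen_vertex (hk : ∀ a : M, k.gen * a = a ∧ a * k.gen = a)
    {γ δ : Cones (LeftIdeal M)}
    (h : elt (γ.cone.app k) = elt (δ.cone.app k)) : γ.vertex.gen * δ.vertex.gen = γ.vertex.gen := by
  obtain ⟨c, hc⟩ := γ.cone.exists_iso
  have h1 : elt (inv (γ.cone.app c)) * (c.gen * elt (γ.cone.app k)) = γ.vertex.gen := by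
    rw [← app_eq_toTop hk, ← elt_comp, IsIso.inv_hom_id, elt_id]
  rw [← h1, h, mul_assoc, mul_assoc, elt_mul_gen]

theorem elt_app_injective (hk : ∀ a : M, k.gen * a = a ∧ a * k.gen = a) :
    Function.Injective fun γ : Cones (LeftIdeal M) => elt (γ.cone.app k) := by
  intro γ δ h
  have hv : γ.vertex = δ.vertex :=
    gen_injective (gen_vertex_mul_gen_vertex hk h) (gen_vertex_mul_gen_vertex hk h.symm)
  obtain ⟨z, γ⟩ := γ
  obtain ⟨w, δ⟩ := δ
  obtain rfl : z = w := hv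
  congr 1
  ext x
  refine hom_ext ?_
  rw [app_eq_toTop hk, app_eq_toTop hk δ]
  exact congrArg (x.gen * ·) h

variable [IsRegularSemigroup M]

/-- `f` and `f°` are represented by the same element, and every component of `δ` is a restriction of
the one at `k`. -/
theorem elt_app_mul (hk : ∀ a : M, k.gen * a = a ∧ a * k.gen = a)
    (γ δ : Cones (LeftIdeal M)) :
    elt ((γ * δ).cone.app k) = elt (γ.cone.app k) * elt (δ.cone.app k) := by
  have h1 : elt (inclPart (δ.cone.app γ.vertex)) = (im (δ.cone.app γ.vertex)).gen :=
    (incl_iff _).1 (inclPart_incl (δ.cone.app γ.vertex))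
  have h : elt (epiPart (δ.cone.app γ.vertex)) = elt (δ.cone.app γ.vertex) := by
    conv_rhs => rw [← epiPart_inclPart (δ.cone.app γ.vertex)]
    rw [elt_comp, h1, elt_mul_gen]
  change elt (γ.cone.app k) * elt (epiPart (δ.cone.app γ.vertex)) = _
  rw [h, app_eq_toTop hk δ.cone, ← mul_assoc, elt_mul_gen]

/-- The cone of inclusions into `k`, followed by the split epimorphism `M ⟶ Ma` of right translation
by `a`, has component `a` at `k`. -/
theorem elt_app_surjective (hk : ∀ a : M, k.gen * a = a ∧ a * k.gen = a) :
    Function.Surjective fun γ : Cones (LeftIdeal M) => elt (γ.cone.app k) := by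
  intro a
  obtain ⟨z, b, h1, h2, h3, -⟩ := exists_gen a
  let f : k ⟶ z := ofElt a (hk a).1 h1
  have hf : (ofElt b h3 (hk b).2 : z ⟶ k) ≫ f = 𝟙 z := hom_ext h2
  have : Epi f := (SplitEpi.mk _ hf).epi
  refine ⟨⟨z, (translationCone k).star f⟩, ?_⟩
  change k.gen * k.gen * a = a
  rw [gen_mul_gen, (hk a).1]

/-- The semigroup of cones in the category of principal left ideals of `M` is isomorphic
to `M`. -/
noncomputable def conesEquiv (hk : ∀ a : M, k.gen * a = a ∧ a * k.gen = a) :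
    Cones (LeftIdeal M) ≃* M :=
  { Equiv.ofBijective _ ⟨elt_app_injective hk, elt_app_surjective hk⟩ with
    map_mul' := elt_app_mul hk }

end LeftIdeal

end LeftIdeals

/-! ### Essential surjectivity and the equivalence -/

instance : conesFunctor.{u}.EssSurj where
  mem_essImage S := by
    obtain ⟨hS, e, he⟩ := S.property
    obtain ⟨k, hk⟩ := LeftIdeal.exists_top he
    let X : ConnectedCategory.{u} :=
      { carrier := LeftIdeal S.obj
        downSet := ⊤
        connected := fun c => ⟨_, trivial, idCone c, idCone_mul_idCone c, rfl⟩ }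
    exact ⟨⟨X, rfl, k, fun c => ⟨LeftIdeal.toTop hk c, rfl⟩⟩,
      ⟨ObjectProperty.isoMk _ (LeftIdeal.conesEquiv hk).toSemigrpIso⟩⟩

instance : conesFunctor.{u}.IsEquivalence where

end ConnCat

theorem theorem7 :
    (∀ (C : Type u) [Category.{v} C] [ConnCat.SubobjectCategory C] [ConnCat.IsNormalCategory C],
      ConnCat.IsBoundedAbove C → ConnCat.IsRegularMonoid (ConnCat.Cones C)) ∧
    Nonempty (CategoryTheory.Equivalence ConnCat.RegularMonoid.{u}
      ConnCat.BoundedAboveNormalCategory.{u}) :=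
  ⟨fun _ => ConnCat.isRegularMonoid_cones, ⟨ConnCat.conesFunctor.asEquivalence.symm⟩⟩
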